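/- **Definitions.** A real matrix with linearly ordered row and column indices is totally positive (TP) if every finite square submatrix has nonnegative determinant. For a $p\times q$ matrix $\mathcal A=(A_{ij}(x))$, $0\le i<p$, $0\le j<q$, of formal power series in $\mathbb R[[x]]$, let $\mathrm{Lace}(\mathcal A)$ be the $\mathbb Z\times\mathbb Z$ matrix whose $(pu'+i,\,qv'+j)$-entry ($u',v'\in\mathbb Z$, $0\le i<p$, $0\le j<q$) is the coefficient of $x^{v'-u'}$ in $A_{ij}(x)$, taken to be $0$ if $v'<u'$. The matrix $\mathcal A$ is *fully interlacing* if $\mathrm{Lace}(\mathcal A)$ is TP; a sequence of power series is regarded as a column matrix. For $A(x),B(x)\in\mathbb R[[x]]$ write $A\prec B$ if the column $(A\ \,B)^\top$ is fully interlacing. For polynomials $P(x),Q(x)\in\mathbb R[x]$ write $P\prec Q$ ("$P$ interlaces $Q$", in the classical sense) if both have nonnegative coefficients and each of them is zero or has only real roots, and moreover either at least one of them is zero, or the roots $\eta_1,\eta_2,\dots$ of $P$ and $\theta_1,\theta_2,\dots$ of $Q$, counted with multiplicity, can be listed so that $\cdots\le\eta_2\le\theta_2\le\eta_1\le\theta_1\le0$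 (so that $\deg Q\in\{\deg P,\deg P+1\}$). A sequence $(P_0,\dots,P_{m-1})$ of polynomials is *pairwise interlacing* if $P_i\prec P_j$ for all $0\le i<j\le m-1$. For a positive integer $r$, an integer $0\le k<r$ and $A(x)=\sum_{n\ge0}a_nx^n$, the $k$th Veronese $r$-section of $A$ is $\mathcal S_k^{(r)}A(x)=\sum_{n\ge0}a_{k+rn}x^n$. The flip $\mathcal A^\bot$ of a $p\times q$ matrix $\mathcal A$ is the $q\times p$ matrix with $(j,i)$-entry $A_{p-1-i,\,q-1-j}$; thus the flip of a row is the column that lists its entries from right to left. **Statement.** Let $r$ be a positive integer. (a) If $A(x),B(x)\in\mathbb R[[x]]$ and $A\prec B$ as power series, then the sequence $$\bigl(\mathcal S_0^{(r)}B\ \ \mathcal S_0^{(r)}A\ \ \mathcal S_1^{(r)}B\ \ \mathcal S_1^{(r)}A\ \cdots\ \mathcal S_{r-1}^{(r)}B\ \ \mathcal S_{r-1}^{(r)}A\bigr)^\bot$$ is fully interlacing. (b) If $P(x),Q(x)\in\mathbb R[x]$ and $P\prec Q$ in the classical sense, then the sequence of polynomials $$\bigl(\mathcal S_0^{(r)}Q\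 \ \mathcal S_0^{(r)}P\ \ \mathcal S_1^{(r)}Q\ \ \mathcal S_1^{(r)}P\ \cdots\ \mathcal S_{r-1}^{(r)}Q\ \ \mathcal S_{r-1}^{(r)}P\bigr)^\bot$$ is pairwise interlacing in the classical sense. In particular, $\mathcal S_k^{(r)}P\prec\mathcal S_k^{(r)}Q$ for all $0\le k<r$. -/

import Mathlib

open scoped PowerSeries Polynomial

namespace Interlacing

/-- A matrix over the reals with ordered row and column indices is totally positive when every
finite square submatrix has nonnegative determinant. -/
def IsTP {m n : Type*} [Preorder m] [Preorder n] (M : Matrix m n ℝ) : Prop :=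
  ∀ (s : ℕ) (f : Fin s → m) (g : Fin s → n), StrictMono f → StrictMono g →
    0 ≤ (M.submatrix f g).det

/-- The coefficient of `x ^ n` in a power series, for an integer `n`;
it is zero when `n` is negative. -/
noncomputable def zcoeff (n : ℤ) (A : ℝ⟦X⟧) : ℝ :=
  if 0 ≤ n then PowerSeries.coeff n.toNat A else 0

/-- The interlacing matrix of a `p × q` matrix of power series, indexed by the integers:
if `u = p u' + i` and `v = q v' + j` with `0 ≤ i < p` and `0 ≤ j < q`, then its `(u, v)` entry
is the coefficient of `x ^ (v' - u')` in the `(i, j)` entry of the given matrix. -/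
noncomputable def lace {p q : ℕ} [NeZero p] [NeZero q] (M : Matrix (Fin p) (Fin q) ℝ⟦X⟧) :
    Matrix ℤ ℤ ℝ :=
  fun u v => zcoeff ((Int.divModEquiv q v).1 - (Int.divModEquiv p u).1)
    (M (Int.divModEquiv p u).2 (Int.divModEquiv q v).2)

/-- A matrix of power series is fully interlacing when its interlacing matrix is totally
positive. Sequences are matrices with one column. -/
def IsFullyInterlacing {p q : ℕ} [NeZero p] [NeZero q] (M : Matrix (Fin p) (Fin q) ℝ⟦X⟧) :
    Prop :=
  IsTP (lace M)

/-- The interlacing relation of power series: the column with entries `A` and `B`,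
from top to bottom, has a totally positive interlacing matrix. -/
def SeriesInterlaces (A B : ℝ⟦X⟧) : Prop :=
  IsFullyInterlacing !![A; B]

/-- A real polynomial is real-rooted when it is zero or all its complex roots are real. -/
def IsRealRooted (P : ℝ[X]) : Prop :=
  P = 0 ∨ ∀ z : ℂ, Polynomial.aeval z P = 0 → z.im = 0

/-- The roots `η 0, η 1, …` of `P` and `θ 0, θ 1, …` of `Q`, listed with multiplicity, alternate:
`⋯ ≤ η 1 ≤ θ 1 ≤ η 0 ≤ θ 0 ≤ 0`. Meant for nonzero polynomials. -/
def RootsAlternate (P Q : ℝ[X]) : Prop :=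
  (Q.natDegree = P.natDegree ∨ Q.natDegree = P.natDegree + 1) ∧
  ∃ η θ : ℕ → ℝ,
    P.roots = (Multiset.range P.natDegree).map η ∧
    Q.roots = (Multiset.range Q.natDegree).map θ ∧
    (∀ i < P.natDegree, η i ≤ θ i) ∧
    (∀ i, i + 1 < Q.natDegree → θ (i + 1) ≤ η i) ∧
    (∀ i < Q.natDegree, θ i ≤ 0)

/-- The classical interlacing relation of polynomials: both are real-rooted with nonnegative
coefficients, and their roots alternate; the zero polynomial interlaces and is interlaced by
every real-rooted polynomial with nonnegative coefficients. -/
def PolyInterlaces (P Q : ℝ[X]) : Prop :=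
  (IsRealRooted P ∧ ∀ n, 0 ≤ P.coeff n) ∧
  (IsRealRooted Q ∧ ∀ n, 0 ≤ Q.coeff n) ∧
  (P = 0 ∨ Q = 0 ∨ RootsAlternate P Q)

/-- A sequence of polynomials, written as a column, is pairwise interlacing when every entry
interlaces, in the classical sense, each of the entries below it. -/
def IsPairwiseInterlacing {p : ℕ} (M : Matrix (Fin p) (Fin 1) ℝ[X]) : Prop :=
  ∀ i j : Fin p, i < j → PolyInterlaces (M i 0) (M j 0)

/-- The `k`-th Veronese `r`-section of a power series. -/
noncomputable def seriesSection (r k : ℕ) (A : ℝ⟦X⟧) : ℝ⟦X⟧ :=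
  PowerSeries.mk fun n => PowerSeries.coeff (k + r * n) A

/-- The `k`-th Veronese `r`-section of a polynomial, as a polynomial (for positive `r`). -/
noncomputable def polySection (r k : ℕ) (P : ℝ[X]) : ℝ[X] :=
  ∑ n ∈ Finset.range (P.natDegree + 1), Polynomial.monomial n (P.coeff (k + r * n))

theorem coeff_polySection (r k : ℕ) (hr : 0 < r) (P : ℝ[X]) (n : ℕ) :
    (polySection r k P).coeff n = P.coeff (k + r * n) := by
  have hn : n ≤ k + r * n := le_add_left (Nat.le_mul_of_pos_left n hr)
  simp only [polySection, Polynomial.finsetSum_coeff, Polynomial.coeff_monomial]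
  rw [Finset.sum_ite_eq' (Finset.range (P.natDegree + 1)) n]
  split_ifs with h
  · rfl
  · rw [Finset.mem_range, not_lt] at h
    exact (Polynomial.coeff_eq_zero_of_natDegree_lt (by omega)).symm

theorem coe_polySection (r k : ℕ) (hr : 0 < r) (P : ℝ[X]) :
    (polySection r k P : ℝ⟦X⟧) = seriesSection r k (P : ℝ⟦X⟧) := by
  ext n
  simp [seriesSection, coeff_polySection r k hr]

/-- The flip of a matrix, its reflection across the reverse diagonal: the `(j, i)` entry of the
flip of a `p × q` matrix is the `(p - 1 - i, q - 1 - j)` entry of that matrix. -/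
def antiflip {R : Type*} {p q : ℕ} (M : Matrix (Fin p) (Fin q) R) : Matrix (Fin q) (Fin p) R :=
  fun j i => M i.rev j.rev

/-- The row `(b 0, a 0, b 1, a 1, …, b (r - 1), a (r - 1))`. -/
def interleavedRow {R : Type*} (r : ℕ) (b a : ℕ → R) : Matrix (Fin 1) (Fin (2 * r)) R :=
  fun _ j => if (j : ℕ) % 2 = 0 then b (j / 2) else a (j / 2)

end Interlacing

open Interlacing

/-!
For power series, the interlacing matrix of the flipped sequence of sections is a submatrix of the
interlacing matrix of the column `A`, `B`: all rows are kept, in their order, and one column out of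
`r` (`lace_sections`). Total positivity passes to it.

For polynomials no total positivity is needed. Alternation of roots is rephrased as a condition on
root counts in upper sets (`CountInterlaces`), which needs no sorted lists and is visibly invariant
under common linear factors and, for nonpositive roots, under `(f, g) ↦ (g, X f)`. The intermediate
value theorem shows that `f ≺ h` and `g ≺ h` imply `f + g ≺ h` (`CountInterlaces.add`); by the
previous invariance `f ≺ g` and `f ≺ h` imply `f ≺ g + h`. If the common polynomial, `h` or
`f`, is zero, these rules need the sum to be real-rooted, since zero imposes no condition.

For a single real-rooted `P` the sections, listed by decreasing index, interlace pairwise, by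
induction on the number of roots: the sections of `(X - a) P` with `a ≤ 0` are `-a` times the
sections of `P` plus the sections of `X P`, which are those of `P` shifted cyclically
(`SectionsInterlace.X_sub_C_mul`). For a pair `P ≺ Q`, partial fractions write `P` as a nonnegative
combination of `Q` and the quotients of `Q` by its linear factors
(`CountInterlaces.mem_quotientCone`). By additivity it is enough to treat `P = q` with
`Q = (X - t) q`, where all relations reduce to those among the sections of `q`
(`PolyInterlaces.sections`).
-/

namespace Interlacing

open Polynomial

/-! ### Counting roots in upper sets -/

/-- The number of roots of `p` in `s`, counted with multiplicity. -/
noncomputable def rootCount (p : ℝ[X]) (s : Set ℝ) : ℕ :=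
  open Classical in p.roots.countP (· ∈ s)

/-- Interlacing in terms of root counts: in every upper set of the line, `g` has as many roots as
`f` or one more. For polynomials with real roots only this says that the decreasing lists of roots
alternate, the largest one belonging to `g`; see `CountInterlaces.rootsAlternate`. Quantifying over
all upper sets covers closed and open half-lines, which together see multiplicities. -/
def CountInterlaces (f g : ℝ[X]) : Prop :=
  ∀ s : Set ℝ, IsUpperSet s →
    rootCount f s ≤ rootCount g s ∧ rootCount g s ≤ rootCount f s + 1

/-- Real-rooted polynomials with positive leading coefficient. -/
def IsPosSplit (p : ℝ[X]) : Prop :=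
  p.Splits ∧ 0 < p.leadingCoeff

theorem IsPosSplit.ne_zero {p : ℝ[X]} (hp : IsPosSplit p) : p ≠ 0 :=
  leadingCoeff_ne_zero.1 hp.2.ne'

theorem isPosSplit_X_sub_C_mul {p : ℝ[X]} {a : ℝ} :
    IsPosSplit ((X - C a) * p) ↔ IsPosSplit p := by
  simp [IsPosSplit, splits_X_sub_C_mul_iff]

theorem rootCount_X_sub_C_mul {p : ℝ[X]} (hp : p ≠ 0) (a : ℝ) (s : Set ℝ) [Decidable (a ∈ s)] :
    rootCount ((X - C a) * p) s = rootCount p s + if a ∈ s then 1 else 0 := by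
  classical
  rw [rootCount, roots_mul (mul_ne_zero (X_sub_C_ne_zero a) hp), roots_X_sub_C,
    Multiset.singleton_add, Multiset.countP_cons]
  congr

theorem rootCount_univ {p : ℝ[X]} (hp : p.Splits) : rootCount p Set.univ = p.natDegree := by
  simp [rootCount, hp.natDegree_eq_card_roots]

theorem rootCount_Ici (p : ℝ[X]) (t : ℝ) :
    rootCount p (Set.Ici t) = rootCount p (Set.Ioi t) + p.roots.count t := by
  classical
  simp only [rootCount, Set.mem_Ici, Set.mem_Ioi]
  generalize p.roots = m
  induction m using Multiset.induction_on with
  | empty => simp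
  | cons a m ih =>
    simp only [Multiset.countP_cons, Multiset.count_cons, ih]
    rcases lt_trichotomy t a with h | h | h
    · simp [h, h.le, h.ne]; omega
    · simp [h]; omega
    · simp [h.not_ge, h.not_gt, h.ne']

theorem countInterlaces_X_sub_C_mul {f g : ℝ[X]} (hf : f ≠ 0) (hg : g ≠ 0) (a : ℝ) :
    CountInterlaces ((X - C a) * f) ((X - C a) * g) ↔ CountInterlaces f g := by
  classical
  refine forall₂_congr fun s _ => ?_
  rw [rootCount_X_sub_C_mul hf, rootCount_X_sub_C_mul hg]
  omega

theorem CountInterlaces.refl (f : ℝ[X]) : CountInterlaces f f :=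
  fun _ _ => ⟨le_rfl, Nat.le_succ _⟩

theorem CountInterlaces.natDegree {f g : ℝ[X]} (hf : f.Splits) (hg : g.Splits)
    (h : CountInterlaces f g) :
    f.natDegree ≤ g.natDegree ∧ g.natDegree ≤ f.natDegree + 1 := by
  simpa only [rootCount_univ hf, rootCount_univ hg] using h Set.univ isUpperSet_univ

/-- `f` interlaces `(X - a) f`. -/
theorem countInterlaces_X_sub_C_mul_self {f : ℝ[X]} (hf : f ≠ 0) (a : ℝ) :
    CountInterlaces f ((X - C a) * f) := by
  classical
  intro s _
  rw [rootCount_X_sub_C_mul hf]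
  split_ifs <;> omega

/-- When all roots are nonpositive, adjoining to `f` the largest possible root `0` swaps the roles
of the two polynomials. -/
theorem countInterlaces_X_mul_iff {f g : ℝ[X]} (hf : f ≠ 0)
    (hf0 : ∀ x ∈ f.roots, x ≤ 0) (hg0 : ∀ x ∈ g.roots, x ≤ 0) :
    CountInterlaces g (X * f) ↔ CountInterlaces f g := by
  classical
  have hX : (X : ℝ[X]) * f = (X - C 0) * f := by simp
  refine forall₂_congr fun s hs => ?_
  rw [hX, rootCount_X_sub_C_mul hf]
  split_ifs with h0
  · omega
  · have hz : ∀ p : ℝ[X], (∀ x ∈ p.roots, x ≤ 0) → rootCount p s = 0 := fun p hp =>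
      Multiset.countP_eq_zero.2 fun x hx hxs => h0 (hs (hp x hx) hxs)
    simp [hz f hf0, hz g hg0]

theorem CountInterlaces.roots_nonpos {f g : ℝ[X]} (h : CountInterlaces f g)
    (hg : ∀ x ∈ g.roots, x ≤ 0) : ∀ x ∈ f.roots, x ≤ 0 := by
  classical
  have h1 := (h (Set.Ioi 0) (isUpperSet_Ioi 0)).1
  have h2 : rootCount g (Set.Ioi 0) = 0 :=
    Multiset.countP_eq_zero.2 fun x hx => not_lt.2 (hg x hx)
  rw [h2, Nat.le_zero] at h1
  exact fun x hx => not_lt.1 (Multiset.countP_eq_zero.1 h1 x hx)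

/-! ### Root counts and alternating lists of roots -/

theorem countP_map_range (η : ℕ → ℝ) (m : ℕ) (s : Set ℝ) [DecidablePred (· ∈ s)] :
    ((Multiset.range m).map η).countP (· ∈ s) =
      ((Finset.range m).filter fun i => η i ∈ s).card := by
  rw [Multiset.countP_map]
  rfl

theorem countInterlaces_of_listings {f g : ℝ[X]}
    (hd : g.natDegree = f.natDegree ∨ g.natDegree = f.natDegree + 1) {η θ : ℕ → ℝ}
    (hη : f.roots = (Multiset.range f.natDegree).map η)
    (hθ : g.roots = (Multiset.range g.natDegree).map θ)
    (h1 : ∀ i < f.natDegree, η i ≤ θ i)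
    (h2 : ∀ i, i + 1 < g.natDegree → θ (i + 1) ≤ η i) : CountInterlaces f g := by
  classical
  intro s hs
  have e1 : rootCount f s = ((Finset.range f.natDegree).filter fun i => η i ∈ s).card := by
    rw [rootCount, hη]
    exact countP_map_range η _ s
  have e2 : rootCount g s = ((Finset.range g.natDegree).filter fun i => θ i ∈ s).card := by
    rw [rootCount, hθ]
    exact countP_map_range θ _ s
  rw [e1, e2]
  constructor
  · refine Finset.card_le_card fun i hi => ?_
    simp only [Finset.mem_filter, Finset.mem_range] at hi ⊢
    exact ⟨by omega, hs (h1 i hi.1) hi.2⟩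
  · refine le_trans (Finset.card_le_card (t := insert 0
      (((Finset.range f.natDegree).filter fun i => η i ∈ s).image (· + 1))) fun i hi => ?_)
      ((Finset.card_insert_le _ _).trans (Nat.add_le_add_right Finset.card_image_le 1))
    simp only [Finset.mem_filter, Finset.mem_range] at hi
    rcases i with _ | i
    · simp
    · refine Finset.mem_insert_of_mem (Finset.mem_image_of_mem _ ?_)
      simp only [Finset.mem_filter, Finset.mem_range]
      exact ⟨by omega, hs (h2 i hi.1) hi.2⟩

theorem RootsAlternate.countInterlaces {f g : ℝ[X]} (h : RootsAlternate f g) :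
    CountInterlaces f g := by
  obtain ⟨hd, η, θ, hη, hθ, h1, h2, -⟩ := h
  exact countInterlaces_of_listings hd hη hθ h1 h2

/-- A multiset of reals can be listed in decreasing order: the `i`-th element (from zero) is at
least `t` exactly when more than `i` elements are. -/
theorem exists_decreasing_listing (m : Multiset ℝ) :
    ∃ η : ℕ → ℝ, m = (Multiset.range m.card).map η ∧
      ∀ i < m.card, ∀ t, t ≤ η i ↔ i < m.countP (t ≤ ·) := by
  suffices H : ∀ l : List ℝ, l.Pairwise (· ≥ ·) →
      ∃ η : ℕ → ℝ, l = (List.range l.length).map η ∧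
        ∀ i < l.length, ∀ t, t ≤ η i ↔ i < l.countP (t ≤ ·) by
    obtain ⟨η, h1, h2⟩ := H (m.sort (· ≥ ·)) (m.pairwise_sort _)
    have hm : ((m.sort (· ≥ ·) : List ℝ) : Multiset ℝ) = m := m.sort_eq _
    have hc : (m.sort (· ≥ ·)).length = m.card := m.length_sort _
    refine ⟨η, ?_, fun i hi t => ?_⟩
    · conv_lhs => rw [← hm, h1, hc]
      rfl
    · rw [h2 i (hc ▸ hi) t, ← Multiset.coe_countP, hm]
  intro l hl
  induction l with
  | nil => exact ⟨fun _ => 0, rfl, by simp⟩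
  | cons a l ih =>
    obtain ⟨ha, hl⟩ := List.pairwise_cons.1 hl
    obtain ⟨η, h1, h2⟩ := ih hl
    refine ⟨fun i => Nat.casesOn i a η, ?_, fun i hi t => ?_⟩
    · rw [List.length_cons, List.range_succ_eq_map, List.map_cons, List.map_map]
      exact congrArg (a :: ·) h1
    · have hz : ¬ t ≤ a → l.countP (t ≤ ·) = 0 := fun h =>
        List.countP_eq_zero.2 fun x hx => by
          simpa using lt_of_le_of_lt (ha x hx) (not_le.1 h)
      rw [List.countP_cons]
      rcases i with _ | i
      · by_cases h : t ≤ a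
        · simp [h]
        · simp [h, hz h]
      · have hi' : i < l.length := by simpa using hi
        by_cases h : t ≤ a
        · simp [h, h2 i hi' t]
        · have := h2 i hi' t
          rw [hz h] at this
          simp [h, hz h, this]

theorem CountInterlaces.rootsAlternate {f g : ℝ[X]} (hf : f.Splits) (hg : g.Splits)
    (hg0 : ∀ x ∈ g.roots, x ≤ 0) (h : CountInterlaces f g) : RootsAlternate f g := by
  classical
  have hd := h.natDegree hf hg
  obtain ⟨η, hη, hη'⟩ := exists_decreasing_listing f.roots
  obtain ⟨θ, hθ, hθ'⟩ := exists_decreasing_listing g.roots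
  rw [← hf.natDegree_eq_card_roots] at hη hη'
  rw [← hg.natDegree_eq_card_roots] at hθ hθ'
  have key : ∀ t, f.roots.countP (t ≤ ·) ≤ g.roots.countP (t ≤ ·) ∧
      g.roots.countP (t ≤ ·) ≤ f.roots.countP (t ≤ ·) + 1 := fun t => by
    convert h (Set.Ici t) (isUpperSet_Ici t) using 2 <;> simp [rootCount]
  refine ⟨by omega, η, θ, hη, hθ, fun i hi => ?_, fun i hi => ?_, fun i hi => ?_⟩
  · rw [hθ' i (by omega)]
    exact ((hη' i hi _).1 le_rfl).trans_le (key _).1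
  · rw [hη' i (by omega)]
    have := (hθ' (i + 1) hi _).1 le_rfl
    have := (key (θ (i + 1))).2
    omega
  · refine hg0 _ ?_
    rw [hθ]
    exact Multiset.mem_map_of_mem _ (Multiset.mem_range.2 hi)

/-! ### Signs at the roots of an interlaced polynomial -/

theorem IsPosSplit.sign_eval {p : ℝ[X]} (hp : IsPosSplit p) {t : ℝ} (ht : p.eval t ≠ 0) :
    0 < (-1) ^ rootCount p (Set.Ioi t) * p.eval t := by
  classical
  have hm : t ∉ p.roots := fun h => ht (isRoot_of_mem_roots h)
  rw [hp.1.eval_eq_prod_roots, mul_left_comm]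
  refine mul_pos hp.2 ?_
  rw [rootCount]
  generalize p.roots = m at hm
  induction m using Multiset.induction_on with
  | empty => simp
  | cons a m ih =>
    obtain ⟨hne, hm⟩ := not_or.1 (Multiset.mem_cons.not.1 hm)
    have := ih hm
    simp only [Set.mem_Ioi] at this
    simp only [Multiset.countP_cons, Multiset.map_cons, Multiset.prod_cons, Set.mem_Ioi]
    by_cases h : t < a
    · rw [if_pos h, pow_succ]
      linear_combination mul_pos (sub_pos.2 h) this
    · rw [if_neg h, add_zero, mul_left_comm]
      exact mul_pos (sub_pos.2 (lt_of_le_of_ne (not_lt.1 h) (Ne.symm hne))) this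

/-- At a root of `h` where `f` does not vanish, `h` has a simple root and as many roots further
right as `f`. -/
theorem CountInterlaces.of_isRoot {f h : ℝ[X]} (hh : h ≠ 0)
    (hfh : CountInterlaces f h) {t : ℝ} (ht : h.eval t = 0) (hft : f.eval t ≠ 0) :
    h.roots.count t = 1 ∧ rootCount f (Set.Ioi t) = rootCount h (Set.Ioi t) := by
  have h1 := hfh _ (isUpperSet_Ioi t)
  have h2 := hfh _ (isUpperSet_Ici t)
  rw [rootCount_Ici, rootCount_Ici] at h2
  have h3 : 0 < h.roots.count t := Multiset.count_pos.2 ((mem_roots hh).2 ht)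
  have h4 : f.roots.count t = 0 :=
    Multiset.count_eq_zero.2 fun hx => hft (isRoot_of_mem_roots hx)
  omega

theorem CountInterlaces.sign_eval {f h : ℝ[X]} (hf : IsPosSplit f) (hh : h ≠ 0)
    (hfh : CountInterlaces f h) {t : ℝ} (ht : h.eval t = 0) (hft : f.eval t ≠ 0) :
    0 < (-1) ^ rootCount h (Set.Ioi t) * f.eval t := by
  rw [← (hfh.of_isRoot hh ht hft).2]
  exact hf.sign_eval hft

theorem CountInterlaces.sign_eval_nonneg {f h : ℝ[X]} (hf : IsPosSplit f) (hh : h ≠ 0)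
    (hfh : CountInterlaces f h) {t : ℝ} (ht : h.eval t = 0) :
    0 ≤ (-1) ^ rootCount h (Set.Ioi t) * f.eval t := by
  by_cases hft : f.eval t = 0
  · simp [hft]
  · exact (hfh.sign_eval hf hh ht hft).le

/-! ### Sums of polynomials interlacing a common one -/

theorem leadingCoeff_add_pos {f g : ℝ[X]} (hf : 0 < f.leadingCoeff) (hg : 0 < g.leadingCoeff) :
    0 < (f + g).leadingCoeff := by
  rcases lt_trichotomy f.degree g.degree with h | h | h
  · rwa [leadingCoeff_add_of_degree_lt h]
  · rw [leadingCoeff_add_of_degree_eq h (add_pos hf hg).ne']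
    exact add_pos hf hg
  · rwa [leadingCoeff_add_of_degree_lt' h]

/-- Arbitrarily far to the left, a polynomial with positive leading coefficient has the sign given
by the parity of its degree. -/
theorem exists_lt_sign_eval {p : ℝ[X]} (hp : 0 < p.leadingCoeff) (hd : 0 < p.natDegree) (a : ℝ) :
    ∃ y < a, 0 < (-1) ^ p.natDegree * p.eval y := by
  set q : ℝ[X] := C ((-1) ^ p.natDegree) * p.comp (-X) with hq
  have hs : ((-1 : ℝ) ^ p.natDegree) * (-1) ^ p.natDegree = 1 := by
    rw [← mul_pow]; simp
  have hlead : q.leadingCoeff = p.leadingCoeff := by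
    rw [hq, leadingCoeff_mul, leadingCoeff_C, leadingCoeff_comp (by simp)]
    simp only [leadingCoeff_neg, leadingCoeff_X]
    linear_combination p.leadingCoeff * hs
  have hdeg : q.natDegree = p.natDegree := by
    rw [hq, natDegree_C_mul (by simp), natDegree_comp]
    simp
  have ht := tendsto_atTop_of_leadingCoeff_nonneg q
    (natDegree_pos_iff_degree_pos.1 (hdeg ▸ hd)) (hlead ▸ hp.le)
  obtain ⟨x, hx1, hx2⟩ := ((ht.eventually_gt_atTop 0).and
    (Filter.eventually_gt_atTop (-a))).exists
  refine ⟨-x, by linarith, ?_⟩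
  simpa [hq] using hx1

/-- A polynomial whose values at the roots of `h`, all simple, have the signs they would have if it
interlaced `h`, interlaces `h`: the intermediate value theorem gives as many roots as the degree
allows. -/
theorem splits_and_countInterlaces_of_sign {F h : ℝ[X]} (hF : 0 < F.leadingCoeff)
    (hh : IsPosSplit h) (hdeg : F.natDegree ≤ h.natDegree)
    (hsimple : ∀ t, h.eval t = 0 → h.roots.count t = 1)
    (hsign : ∀ t, h.eval t = 0 → 0 < (-1) ^ rootCount h (Set.Ioi t) * F.eval t) :
    F.Splits ∧ CountInterlaces F h := by
  classical
  obtain ⟨θ, hθ, hθ'⟩ := exists_decreasing_listing h.roots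
  rw [← hh.1.natDegree_eq_card_roots] at hθ hθ'
  set n := h.natDegree
  have hroot : ∀ i < n, h.eval (θ i) = 0 := fun i hi => by
    refine isRoot_of_mem_roots ?_
    rw [hθ]
    exact Multiset.mem_map_of_mem _ (Multiset.mem_range.2 hi)
  have hnodup : h.roots.Nodup := Multiset.nodup_iff_count_le_one.2 fun t => by
    by_cases ht : t ∈ h.roots
    · exact (hsimple t (isRoot_of_mem_roots ht)).le
    · simp [Multiset.count_eq_zero.2 ht]
  have hinj : ∀ i < n, ∀ j < n, θ i = θ j → i = j := fun i hi j hj hij =>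
    Multiset.inj_on_of_nodup_map (hθ ▸ hnodup) i (Multiset.mem_range.2 hi) j
      (Multiset.mem_range.2 hj) hij
  have hanti : ∀ i j, i ≤ j → j < n → θ j ≤ θ i := fun i j hij hj =>
    (hθ' i (by omega) _).2 (hij.trans_lt ((hθ' j hj _).1 le_rfl))
  have hcount : ∀ i < n, rootCount h (Set.Ioi (θ i)) = i := fun i hi => by
    have hN : h.roots.countP (θ i ≤ ·) = rootCount h (Set.Ioi (θ i)) + 1 := by
      rw [← hsimple _ (hroot i hi), ← rootCount_Ici]
      simp [rootCount]
    have hle : h.roots.countP (θ i ≤ ·) ≤ n :=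
      (Multiset.countP_le_card _ _).trans_eq hh.1.natDegree_eq_card_roots.symm
    have hi' := (hθ' i hi _).1 le_rfl
    refine hinj _ (by omega) _ hi (le_antisymm (hanti _ _ (by omega) (by omega)) ?_)
    rw [hθ' _ (by omega), hN]
    omega
  have hsign' : ∀ i < n, 0 < (-1) ^ i * F.eval (θ i) := fun i hi => by
    have := hsign _ (hroot i hi)
    rwa [hcount i hi] at this
  have hIVT : ∀ a b : ℝ, ∀ i, a < b → 0 < (-1) ^ (i + 1) * F.eval a →
      0 < (-1) ^ i * F.eval b → ∃ x, a < x ∧ x < b ∧ F.eval x = 0 := by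
    intro a b i hab ha hb
    have hc : ContinuousOn (fun x => (-1) ^ i * F.eval x) (Set.Icc a b) := by fun_prop
    obtain ⟨x, hx, hx0⟩ := intermediate_value_Ioo hab.le hc
      (show (0 : ℝ) ∈ _ from ⟨by rw [pow_succ] at ha; linarith, hb⟩)
    exact ⟨x, hx.1, hx.2, by simpa using hx0⟩
  -- One root in each gap of the roots of `h`, and one below them all if the degrees agree.
  have hex : ∀ i, i < max F.natDegree (n - 1) →
      ∃ x, F.eval x = 0 ∧ x < θ i ∧ (i + 1 < n → θ (i + 1) < x) := by
    intro i hi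
    by_cases hin : i + 1 < n
    · obtain ⟨x, h1, h2, h3⟩ := hIVT (θ (i + 1)) (θ i) i
        (lt_of_le_of_ne (hanti _ _ (Nat.le_succ i) hin) fun e => by
          have := hinj _ hin _ (by omega) e
          omega) (hsign' _ hin) (hsign' _ (by omega))
      exact ⟨x, h3, h2, fun _ => h1⟩
    · have hm : F.natDegree = i + 1 := by omega
      obtain ⟨y, hy, hy'⟩ := exists_lt_sign_eval hF (by omega) (θ i)
      rw [hm] at hy'
      obtain ⟨x, h1, h2, h3⟩ := hIVT y (θ i) i hy hy' (hsign' _ (by omega))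
      exact ⟨x, h3, h2, fun h => absurd h hin⟩
  choose! ξ hξ0 hξ1 hξ2 using hex
  set k := max F.natDegree (n - 1)
  have hξanti : ∀ i j, i < j → j < k → ξ j < ξ i := fun i j hij hj =>
    (hξ1 j hj).trans_le ((hanti (i + 1) j hij (by omega)).trans
      (hξ2 i (by omega) (by omega)).le)
  have hξnodup : ((Multiset.range k).map ξ).Nodup := by
    refine Multiset.Nodup.map_on (fun i hi j hj hij => ?_) (Multiset.nodup_range k)
    rw [Multiset.mem_range] at hi hj
    by_contra hne
    rcases Nat.lt_or_gt_of_ne hne with hlt | hlt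
    · exact (hξanti _ _ hlt hj).ne' hij
    · exact (hξanti _ _ hlt hi).ne hij
  have hF0 : F ≠ 0 := leadingCoeff_ne_zero.1 hF.ne'
  have hle : (Multiset.range k).map ξ ≤ F.roots := by
    refine (Multiset.le_iff_subset hξnodup).2 fun x hx => ?_
    obtain ⟨i, hi, rfl⟩ := Multiset.mem_map.1 hx
    exact (mem_roots hF0).2 (hξ0 i (Multiset.mem_range.1 hi))
  have hcard := Multiset.card_le_card hle
  rw [Multiset.card_map, Multiset.card_range] at hcard
  have hcard' := F.card_roots'
  have hk : k = F.natDegree := by omega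
  have hroots : F.roots = (Multiset.range F.natDegree).map ξ := by
    refine (Multiset.eq_of_le_of_card_le (hk ▸ hle) ?_).symm
    simpa using hcard'
  refine ⟨splits_iff_card_roots.2 (by omega), countInterlaces_of_listings (by omega) hroots hθ
    (fun i hi => (hξ1 i (hk ▸ hi)).le) fun i hi => (hξ2 i (by omega) hi).le⟩

/-- The polynomials interlacing a fixed one are closed under addition. Common roots are divided
out until the sum has no root in common with `h`; then its signs at the roots of `h` are strict. -/
theorem CountInterlaces.add {f g h : ℝ[X]} (hf : IsPosSplit f) (hg : IsPosSplit g)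
    (hh : IsPosSplit h) (hfh : CountInterlaces f h) (hgh : CountInterlaces g h) :
    IsPosSplit (f + g) ∧ CountInterlaces (f + g) h := by
  induction hn : h.natDegree using Nat.strong_induction_on generalizing f g h with
  | _ n ih =>
    by_cases hc : ∃ t, h.eval t = 0 ∧ (f + g).eval t = 0
    · obtain ⟨t, ht, hst⟩ := hc
      rw [eval_add] at hst
      have hft0 := hfh.sign_eval_nonneg hf hh.ne_zero ht
      have hgt0 := hgh.sign_eval_nonneg hg hh.ne_zero ht
      have hft : f.eval t = 0 := by
        by_contra hne
        have := hfh.sign_eval hf hh.ne_zero ht hne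
        have : 0 < (-1) ^ rootCount h (Set.Ioi t) * (f.eval t + g.eval t) := by
          rw [mul_add]; linarith
        simp [hst] at this
      have hgt : g.eval t = 0 := by linarith
      obtain ⟨h', rfl⟩ := dvd_iff_isRoot.2 ht
      obtain ⟨f', rfl⟩ := dvd_iff_isRoot.2 hft
      obtain ⟨g', rfl⟩ := dvd_iff_isRoot.2 hgt
      rw [isPosSplit_X_sub_C_mul] at hf hg hh
      rw [countInterlaces_X_sub_C_mul (IsPosSplit.ne_zero ‹_›) hh.ne_zero] at hfh hgh
      rw [natDegree_mul (X_sub_C_ne_zero t) hh.ne_zero, natDegree_X_sub_C] at hn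
      have hind := ih _ (by omega) hf hg hh hfh hgh rfl
      rw [← mul_add, isPosSplit_X_sub_C_mul,
        countInterlaces_X_sub_C_mul hind.1.ne_zero hh.ne_zero]
      exact hind
    · have hlead := leadingCoeff_add_pos hf.2 hg.2
      have hdeg : (f + g).natDegree ≤ h.natDegree := (natDegree_add_le f g).trans
        (max_le (hfh.natDegree hf.1 hh.1).1 (hgh.natDegree hg.1 hh.1).1)
      have hor : ∀ t, h.eval t = 0 → f.eval t ≠ 0 ∨ g.eval t ≠ 0 := fun t ht => by
        by_contra! hcon
        exact hc ⟨t, ht, by simp [hcon]⟩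
      obtain ⟨h1, h2⟩ := splits_and_countInterlaces_of_sign hlead hh hdeg
        (fun t ht => (hor t ht).elim (fun hne => (hfh.of_isRoot hh.ne_zero ht hne).1)
          fun hne => (hgh.of_isRoot hh.ne_zero ht hne).1)
        fun t ht => by
          have hft0 := hfh.sign_eval_nonneg hf hh.ne_zero ht
          have hgt0 := hgh.sign_eval_nonneg hg hh.ne_zero ht
          rw [eval_add, mul_add]
          rcases hor t ht with hne | hne
          · exact add_pos_of_pos_of_nonneg (hfh.sign_eval hf hh.ne_zero ht hne) hgt0
          · exact add_pos_of_nonneg_of_pos hft0 (hgh.sign_eval hg hh.ne_zero ht hne)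
      exact ⟨⟨h1, hlead⟩, h2⟩

/-! ### The cone of polynomials interlacing a given one -/

/-- The convex cone spanned by `Q` and the quotients of `Q` by its linear factors. -/
noncomputable def quotientCone (Q : ℝ[X]) : AddSubmonoid ℝ[X] :=
  AddSubmonoid.closure {F | ∃ c : ℝ, 0 ≤ c ∧
    (F = C c * Q ∨ ∃ (t : ℝ) (q : ℝ[X]), Q = (X - C t) * q ∧ F = C c * q)}

theorem X_sub_C_mul_mem_quotientCone {P Q : ℝ[X]} (h : P ∈ quotientCone Q) (a : ℝ) :
    (X - C a) * P ∈ quotientCone ((X - C a) * Q) := by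
  refine AddSubmonoid.closure_induction (fun F hF => ?_) ?_ (fun F G _ _ hF hG => ?_) h
  · obtain ⟨c, hc, rfl | ⟨t, q, rfl, rfl⟩⟩ := hF
    · exact AddSubmonoid.subset_closure ⟨c, hc, Or.inl (by ring)⟩
    · exact AddSubmonoid.subset_closure
        ⟨c, hc, Or.inr ⟨t, (X - C a) * q, by ring, by ring⟩⟩
  · simp
  · rw [mul_add]
    exact add_mem hF hG

/-- Partial fractions: if `P` interlaces `Q`, then in `P / Q = c + ∑ w t / (X - t)` all
coefficients are nonnegative. -/
theorem CountInterlaces.mem_quotientCone {P Q : ℝ[X]} (hP : IsPosSplit P) (hQ : IsPosSplit Q)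
    (h : CountInterlaces P Q) : P ∈ quotientCone Q := by
  classical
  induction hn : Q.natDegree using Nat.strong_induction_on generalizing P Q with
  | _ n ih =>
    by_cases hc : ∃ t, Q.eval t = 0 ∧ P.eval t = 0
    · obtain ⟨t, htQ, htP⟩ := hc
      obtain ⟨Q', rfl⟩ := dvd_iff_isRoot.2 htQ
      obtain ⟨P', rfl⟩ := dvd_iff_isRoot.2 htP
      rw [isPosSplit_X_sub_C_mul] at hP hQ
      rw [countInterlaces_X_sub_C_mul hP.ne_zero hQ.ne_zero] at h
      rw [natDegree_mul (X_sub_C_ne_zero t) hQ.ne_zero, natDegree_X_sub_C] at hn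
      exact X_sub_C_mul_mem_quotientCone (ih _ (by omega) hP hQ h rfl) t
    · replace hc : ∀ t, Q.eval t = 0 → P.eval t ≠ 0 := fun t h1 h2 => hc ⟨t, h1, h2⟩
      have hq : ∀ t, Q.eval t = 0 → ∃ q, Q = (X - C t) * q := fun t ht =>
        dvd_iff_isRoot.2 ht
      choose! q hq using hq
      have hqpos : ∀ t, Q.eval t = 0 → IsPosSplit (q t) := fun t ht =>
        isPosSplit_X_sub_C_mul.1 (hq t ht ▸ hQ)
      have hqt : ∀ t, Q.eval t = 0 → (q t).eval t ≠ 0 := fun t ht h0 => by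
        have h1 := (h.of_isRoot hQ.ne_zero ht (hc t ht)).1
        rw [hq t ht, roots_mul (mul_ne_zero (X_sub_C_ne_zero t) (hqpos t ht).ne_zero),
          roots_X_sub_C, Multiset.singleton_add, Multiset.count_cons_self] at h1
        exact Multiset.count_ne_zero.2 ((mem_roots (hqpos t ht).ne_zero).2 h0) (by omega)
      have hqs : ∀ t, Q.eval t = 0 → 0 < (-1) ^ rootCount Q (Set.Ioi t) * (q t).eval t :=
        fun t ht => by
          have hqQ : CountInterlaces (q t) Q := by
            conv_rhs => rw [hq t ht]
            exact countInterlaces_X_sub_C_mul_self (hqpos t ht).ne_zero t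
          exact hqQ.sign_eval (hqpos t ht) hQ.ne_zero ht (hqt t ht)
      have hmem : ∀ t ∈ Q.roots.toFinset, Q.eval t = 0 := fun t ht =>
        isRoot_of_mem_roots (Multiset.mem_toFinset.1 ht)
      have hcard : Q.roots.toFinset.card = Q.natDegree := by
        rw [hQ.1.natDegree_eq_card_roots]
        refine Multiset.toFinset_card_of_nodup (Multiset.nodup_iff_count_le_one.2 fun t => ?_)
        by_cases ht : t ∈ Q.roots
        · have ht := isRoot_of_mem_roots ht
          exact (h.of_isRoot hQ.ne_zero ht (hc t ht)).1.le
        · simp [Multiset.count_eq_zero.2 ht]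
      have hdP := (h.natDegree hP.1 hQ.1).1
      have hcoeff : 0 ≤ P.coeff Q.natDegree := by
        rcases hdP.eq_or_lt with he | hlt
        · rw [← he]; exact hP.2.le
        · rw [coeff_eq_zero_of_natDegree_lt hlt]
      have hP' : P = C (P.coeff Q.natDegree / Q.leadingCoeff) * Q +
          ∑ t ∈ Q.roots.toFinset, C (P.eval t / (q t).eval t) * q t := by
        refine eq_of_degree_sub_lt_of_eval_finset_eq Q.roots.toFinset ?_ fun t ht => ?_
        · rw [hcard, degree_lt_iff_coeff_zero]
          intro m hm
          have hz : ∀ t ∈ Q.roots.toFinset,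
              (C (P.eval t / (q t).eval t) * q t).coeff m = 0 := fun t ht => by
            have hd := congrArg Polynomial.natDegree (hq t (hmem t ht))
            rw [natDegree_mul (X_sub_C_ne_zero t) (hqpos t (hmem t ht)).ne_zero,
              natDegree_X_sub_C] at hd
            rw [coeff_C_mul, coeff_eq_zero_of_natDegree_lt (by omega), mul_zero]
          rw [coeff_sub, coeff_add, finsetSum_coeff, Finset.sum_eq_zero hz, coeff_C_mul, add_zero]
          rcases hm.eq_or_lt with rfl | hlt
          · rw [coeff_natDegree, div_mul_cancel₀ _ hQ.2.ne', sub_self]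
          · rw [coeff_eq_zero_of_natDegree_lt hlt, coeff_eq_zero_of_natDegree_lt (by omega)]
            simp
        · rw [eval_add, eval_finsetSum, Finset.sum_eq_single_of_mem t ht]
          · simp [hmem t ht, div_mul_cancel₀ _ (hqt t (hmem t ht))]
          · intro u hu hne
            have h0 := hmem t ht
            rw [hq u (hmem u hu), eval_mul, mul_eq_zero] at h0
            have hne' : t - u ≠ 0 := sub_ne_zero.2 (Ne.symm hne)
            simp only [eval_sub, eval_X, eval_C, hne', false_or] at h0
            simp [h0]
      rw [hP']
      refine add_mem (AddSubmonoid.subset_closure ⟨_, div_nonneg hcoeff hQ.2.le, Or.inl rfl⟩)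
        (sum_mem fun t ht => AddSubmonoid.subset_closure
          ⟨_, ?_, Or.inr ⟨t, q t, hq t (hmem t ht), rfl⟩⟩)
      have h1 := h.sign_eval hP hQ.ne_zero (hmem t ht) (hc t (hmem t ht))
      have h2 := hqs t (hmem t ht)
      have h3 := div_pos h1 h2
      rw [mul_div_mul_left _ _ (by simp)] at h3
      exact h3.le

/-! ### Calculus of the interlacing relation -/

/-- Polynomials with nonnegative coefficients, zero or with only real roots: the polynomials on
which `PolyInterlaces` is a relation. -/
def IsNonnegRealRooted (p : ℝ[X]) : Prop :=
  IsRealRooted p ∧ ∀ n, 0 ≤ p.coeff n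

theorem coeff_mul_nonneg {p q : ℝ[X]} (hp : ∀ n, 0 ≤ p.coeff n) (hq : ∀ n, 0 ≤ q.coeff n)
    (n : ℕ) : 0 ≤ (p * q).coeff n := by
  rw [coeff_mul]
  exact Finset.sum_nonneg fun x _ => mul_nonneg (hp _) (hq _)

theorem eval_pos_of_coeff_nonneg {p : ℝ[X]} (hp : ∀ n, 0 ≤ p.coeff n) (h0 : p ≠ 0) {x : ℝ}
    (hx : 0 < x) : 0 < p.eval x := by
  rw [eval_eq_sum_range]
  refine Finset.sum_pos' (fun i _ => mul_nonneg (hp i) (by positivity))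
    ⟨p.natDegree, by simp, mul_pos ?_ (by positivity)⟩
  exact lt_of_le_of_ne (hp _) (leadingCoeff_ne_zero.2 h0).symm

theorem isNonnegRealRooted_iff {p : ℝ[X]} (h0 : p ≠ 0) :
    IsNonnegRealRooted p ↔ IsPosSplit p ∧ ∀ x ∈ p.roots, x ≤ 0 := by
  constructor
  · rintro ⟨hr, hc⟩
    refine ⟨⟨?_, lt_of_le_of_ne (hc _) (leadingCoeff_ne_zero.2 h0).symm⟩, fun x hx => ?_⟩
    · refine Splits.of_splits_map (algebraMap ℝ ℂ) (IsAlgClosed.splits _) fun z hz => ?_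
      have hz0 : aeval z p = 0 := by
        have := isRoot_of_mem_roots hz
        rwa [IsRoot, eval_map_algebraMap] at this
      exact ⟨z.re, Complex.ext rfl (by simpa using (hr.resolve_left h0 z hz0).symm)⟩
    · by_contra! hx0
      exact (eval_pos_of_coeff_nonneg hc h0 hx0).ne' (isRoot_of_mem_roots hx)
  · rintro ⟨⟨hs, hl⟩, hx⟩
    refine ⟨Or.inr fun z hz => ?_, ?_⟩
    · obtain ⟨x, rfl⟩ := hs.mem_range_of_isRoot h0 (i := algebraMap ℝ ℂ) (x := z)
        (by rwa [IsRoot, eval_map_algebraMap])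
      simp
    · rw [hs.eq_prod_roots]
      refine coeff_mul_nonneg (fun n => ?_) ?_
      · rw [coeff_C]
        split_ifs
        exacts [hl.le, le_rfl]
      · generalize p.roots = m at hx
        induction m using Multiset.induction_on with
        | empty =>
          intro n
          rw [Multiset.map_zero, Multiset.prod_zero, coeff_one]
          split_ifs <;> norm_num
        | cons a m ih =>
          rw [Multiset.map_cons, Multiset.prod_cons]
          refine coeff_mul_nonneg (fun n => ?_)
            (ih fun x hxm => hx x (Multiset.mem_cons_of_mem hxm))
          have ha := hx a (Multiset.mem_cons_self a m)
          rw [coeff_sub, coeff_X, coeff_C]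
          split_ifs <;> first | omega | linarith

theorem isNonnegRealRooted_zero : IsNonnegRealRooted 0 :=
  ⟨Or.inl rfl, by simp⟩

theorem IsNonnegRealRooted.C_mul {p : ℝ[X]} (hp : IsNonnegRealRooted p) {c : ℝ} (hc : 0 ≤ c) :
    IsNonnegRealRooted (C c * p) := by
  refine ⟨?_, fun n => by simpa using mul_nonneg hc (hp.2 n)⟩
  rcases hc.eq_or_lt with rfl | hc
  · exact Or.inl (by simp)
  · rcases hp.1 with rfl | h
    · exact Or.inl (by simp)
    · exact Or.inr fun z hz => h z (by simpa [hc.ne'] using hz)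

theorem IsNonnegRealRooted.X_mul {p : ℝ[X]} (hp : IsNonnegRealRooted p) :
    IsNonnegRealRooted (X * p) := by
  refine ⟨?_, coeff_mul_nonneg (fun n => ?_) hp.2⟩
  · rcases hp.1 with rfl | h
    · exact Or.inl (by simp)
    · refine Or.inr fun z hz => ?_
      rw [map_mul, aeval_X, mul_eq_zero] at hz
      rcases hz with rfl | hz
      exacts [rfl, h z hz]
  · rw [coeff_X]
    split_ifs <;> norm_num

theorem polyInterlaces_iff {f g : ℝ[X]} : PolyInterlaces f g ↔
    IsNonnegRealRooted f ∧ IsNonnegRealRooted g ∧ (f = 0 ∨ g = 0 ∨ CountInterlaces f g) := by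
  refine and_congr_right fun hf => and_congr_right fun hg => or_congr_right' fun hf0 =>
    or_congr_right' fun hg0 => ⟨fun h => h.countInterlaces, fun h => ?_⟩
  have hf' := (isNonnegRealRooted_iff hf0).1 hf
  have hg' := (isNonnegRealRooted_iff hg0).1 hg
  exact h.rootsAlternate hf'.1.1 hg'.1.1 hg'.2

theorem IsNonnegRealRooted.zero_interlaces {p : ℝ[X]} (hp : IsNonnegRealRooted p) :
    PolyInterlaces 0 p :=
  ⟨isNonnegRealRooted_zero, hp, Or.inl rfl⟩

theorem IsNonnegRealRooted.interlaces_zero {p : ℝ[X]} (hp : IsNonnegRealRooted p) :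
    PolyInterlaces p 0 :=
  ⟨hp, isNonnegRealRooted_zero, Or.inr (Or.inl rfl)⟩

theorem IsNonnegRealRooted.interlaces_self {p : ℝ[X]} (hp : IsNonnegRealRooted p) :
    PolyInterlaces p p :=
  polyInterlaces_iff.2 ⟨hp, hp, Or.inr (Or.inr (CountInterlaces.refl p))⟩

namespace PolyInterlaces

variable {f g h : ℝ[X]}

theorem left (hfg : PolyInterlaces f g) : IsNonnegRealRooted f := hfg.1

theorem right (hfg : PolyInterlaces f g) : IsNonnegRealRooted g := hfg.2.1

/-- Turning the relation around by a factor `X` transfers statements about its left argument to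
its right argument. -/
theorem swap_iff (hf : IsNonnegRealRooted f) (hg : IsNonnegRealRooted g) :
    PolyInterlaces g (X * f) ↔ PolyInterlaces f g := by
  rw [polyInterlaces_iff, polyInterlaces_iff]
  simp only [hf, hg, hf.X_mul, true_and, mul_eq_zero, X_ne_zero, false_or]
  by_cases hf0 : f = 0
  · simp [hf0]
  by_cases hg0 : g = 0
  · simp [hg0]
  simp only [hf0, hg0, false_or]
  exact countInterlaces_X_mul_iff hf0 ((isNonnegRealRooted_iff hf0).1 hf).2
    ((isNonnegRealRooted_iff hg0).1 hg).2

theorem swap (hfg : PolyInterlaces f g) : PolyInterlaces g (X * f) :=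
  (swap_iff hfg.left hfg.right).2 hfg

/-- Nonvanishing of `h` is essential: any two real-rooted polynomials interlace zero. -/
theorem add_left_of_ne_zero (hh0 : h ≠ 0) (hf : PolyInterlaces f h) (hg : PolyInterlaces g h) :
    PolyInterlaces (f + g) h := by
  by_cases hf0 : f = 0
  · simpa [hf0] using hg
  by_cases hg0 : g = 0
  · simpa [hg0] using hf
  have hf1 := ((isNonnegRealRooted_iff hf0).1 hf.left).1
  have hg1 := ((isNonnegRealRooted_iff hg0).1 hg.left).1
  have hh1 := (isNonnegRealRooted_iff hh0).1 hf.right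
  have hf2 := ((polyInterlaces_iff.1 hf).2.2.resolve_left hf0).resolve_left hh0
  have hg2 := ((polyInterlaces_iff.1 hg).2.2.resolve_left hg0).resolve_left hh0
  obtain ⟨h1, h2⟩ := hf2.add hf1 hg1 hh1.1 hg2
  exact polyInterlaces_iff.2 ⟨(isNonnegRealRooted_iff h1.ne_zero).2
    ⟨h1, h2.roots_nonpos hh1.2⟩, hf.right, Or.inr (Or.inr h2)⟩

theorem add_left (hs : IsNonnegRealRooted (f + g)) (hf : PolyInterlaces f h)
    (hg : PolyInterlaces g h) : PolyInterlaces (f + g) h := by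
  by_cases hh0 : h = 0
  · rw [hh0]
    exact hs.interlaces_zero
  · exact hf.add_left_of_ne_zero hh0 hg

theorem add_right_of_ne_zero (hf0 : f ≠ 0) (hg : PolyInterlaces f g) (hh : PolyInterlaces f h) :
    PolyInterlaces f (g + h) := by
  have hs := hg.swap.add_left_of_ne_zero (mul_ne_zero X_ne_zero hf0) hh.swap
  exact (swap_iff hg.left hs.left).1 hs

theorem add_right (hs : IsNonnegRealRooted (g + h)) (hg : PolyInterlaces f g)
    (hh : PolyInterlaces f h) : PolyInterlaces f (g + h) := by
  by_cases hf0 : f = 0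
  · rw [hf0]
    exact hs.zero_interlaces
  · exact hg.add_right_of_ne_zero hf0 hh

theorem add (hfg : PolyInterlaces f g) : IsNonnegRealRooted (f + g) := by
  by_cases hg0 : g = 0
  · simpa [hg0] using hfg.left
  · exact (hfg.add_left_of_ne_zero hg0 hfg.right.interlaces_self).left

theorem C_mul_left (hfg : PolyInterlaces f g) {c : ℝ} (hc : 0 ≤ c) :
    PolyInterlaces (C c * f) g := by
  rcases hc.eq_or_lt with rfl | hc
  · simpa using hfg.right.zero_interlaces
  · have h := polyInterlaces_iff.1 hfg
    refine polyInterlaces_iff.2 ⟨h.1.C_mul hc.le, h.2.1, ?_⟩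
    simpa [hc.ne', CountInterlaces, rootCount, roots_C_mul f hc.ne'] using h.2.2

theorem C_mul_right (hfg : PolyInterlaces f g) {c : ℝ} (hc : 0 ≤ c) :
    PolyInterlaces f (C c * g) := by
  refine (swap_iff hfg.left (hfg.right.C_mul hc)).1 (hfg.swap.C_mul_left hc)

end PolyInterlaces

/-! ### Sections of a real-rooted polynomial -/

/-- The Veronese sections of `P`, listed by decreasing index, interlace pairwise. -/
def SectionsInterlace (r : ℕ) (P : ℝ[X]) : Prop :=
  ∀ k l, l ≤ k → k < r → PolyInterlaces (polySection r k P) (polySection r l P)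

section Sections

variable {r : ℕ}

theorem polySection_add (hr : 0 < r) (k : ℕ) (P Q : ℝ[X]) :
    polySection r k (P + Q) = polySection r k P + polySection r k Q := by
  ext n
  simp [coeff_polySection r k hr]

theorem polySection_C_mul (hr : 0 < r) (k : ℕ) (c : ℝ) (P : ℝ[X]) :
    polySection r k (C c * P) = C c * polySection r k P := by
  ext n
  simp [coeff_polySection r k hr]

theorem polySection_zero (hr : 0 < r) (k : ℕ) : polySection r k 0 = 0 := by
  ext n
  simp [coeff_polySection r k hr]

theorem polySection_zero_X_mul (hr : 0 < r) (P : ℝ[X]) :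
    polySection r 0 (X * P) = X * polySection r (r - 1) P := by
  ext n
  rw [coeff_polySection r _ hr]
  rcases n with _ | n
  · simp
  · rw [show 0 + r * (n + 1) = (r - 1 + r * n) + 1 by rw [mul_add]; omega, coeff_X_mul,
      coeff_X_mul, coeff_polySection r _ hr]

theorem polySection_succ_X_mul (hr : 0 < r) (k : ℕ) (P : ℝ[X]) :
    polySection r (k + 1) (X * P) = polySection r k P := by
  ext n
  rw [coeff_polySection r _ hr, coeff_polySection r _ hr, add_right_comm, coeff_X_mul]

theorem polySection_X_sub_C_mul (hr : 0 < r) (k : ℕ) (a : ℝ) (P : ℝ[X]) :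
    polySection r k ((X - C a) * P) =
      polySection r k (X * P) + C (-a) * polySection r k P := by
  rw [← polySection_C_mul hr, ← polySection_add hr, map_neg]
  congr 1
  ring

namespace SectionsInterlace

variable {P : ℝ[X]}

theorem section_left (h : SectionsInterlace r P) {k : ℕ} (hk : k < r) :
    IsNonnegRealRooted (polySection r k P) :=
  (h k k le_rfl hk).left

theorem X_mul (h : SectionsInterlace r P) : SectionsInterlace r (X * P) := by
  intro k l hlk hk
  have hr : 0 < r := by omega
  rcases k with _ | k
  · obtain rfl : l = 0 := by omega
    rw [polySection_zero_X_mul hr]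
    exact (h.section_left (by omega)).X_mul.interlaces_self
  · rw [polySection_succ_X_mul hr]
    rcases l with _ | l
    · rw [polySection_zero_X_mul hr]
      exact (h (r - 1) k (by omega) (by omega)).swap
    · rw [polySection_succ_X_mul hr]
      exact h k l (by omega) (by omega)

theorem interlaces_section_X_mul (h : SectionsInterlace r P) {k l : ℕ} (hlk : l ≤ k)
    (hk : k < r) : PolyInterlaces (polySection r k P) (polySection r l (X * P)) := by
  have hr : 0 < r := by omega
  rcases l with _ | l
  · rw [polySection_zero_X_mul hr]
    exact (h (r - 1) k (by omega) (by omega)).swap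
  · rw [polySection_succ_X_mul hr]
    exact h k l (by omega) hk

theorem section_X_mul_interlaces (h : SectionsInterlace r P) {k l : ℕ} (hlk : l < k)
    (hk : k < r) : PolyInterlaces (polySection r k (X * P)) (polySection r l P) := by
  obtain ⟨k, rfl⟩ : ∃ j, k = j + 1 := ⟨k - 1, by omega⟩
  rw [polySection_succ_X_mul (by omega)]
  exact h k l (by omega) (by omega)

/-- Multiplication by `X` permutes the sections cyclically, with a factor `X` on the way from the
last to the first; so the sections of `(X - a) P` are nonnegative combinations of two consecutive,
hence interlacing, terms of the sequence of sections of `P`. -/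
theorem section_X_sub_C_mul (h : SectionsInterlace r P) {a : ℝ} (ha : a ≤ 0) {k : ℕ}
    (hk : k < r) : IsNonnegRealRooted (polySection r k ((X - C a) * P)) := by
  rw [polySection_X_sub_C_mul (by omega), add_comm]
  exact ((h.interlaces_section_X_mul le_rfl hk).C_mul_left (neg_nonneg.2 ha)).add

theorem interlaces_section_X_sub_C_mul (h : SectionsInterlace r P) {a : ℝ} (ha : a ≤ 0)
    {k l : ℕ} (hlk : l ≤ k) (hk : k < r) :
    PolyInterlaces (polySection r k P) (polySection r l ((X - C a) * P)) := by
  have hs := h.section_X_sub_C_mul ha (hlk.trans_lt hk)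
  rw [polySection_X_sub_C_mul (by omega)] at hs ⊢
  exact (h.interlaces_section_X_mul hlk hk).add_right hs
    ((h k l hlk hk).C_mul_right (neg_nonneg.2 ha))

theorem section_X_sub_C_mul_interlaces (h : SectionsInterlace r P) {a : ℝ} (ha : a ≤ 0)
    {k l : ℕ} (hlk : l < k) (hk : k < r) :
    PolyInterlaces (polySection r k ((X - C a) * P)) (polySection r l P) := by
  have hs := h.section_X_sub_C_mul ha hk
  rw [polySection_X_sub_C_mul (by omega)] at hs ⊢
  exact (h.section_X_mul_interlaces hlk hk).add_left hs
    ((h k l hlk.le hk).C_mul_left (neg_nonneg.2 ha))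

theorem X_sub_C_mul (h : SectionsInterlace r P) {a : ℝ} (ha : a ≤ 0) :
    SectionsInterlace r ((X - C a) * P) := by
  intro k l hlk hk
  have hs := h.section_X_sub_C_mul ha (hlk.trans_lt hk)
  rcases hlk.eq_or_lt with rfl | hlt
  · exact hs.interlaces_self
  · have h1 := h.section_X_sub_C_mul_interlaces ha hlt hk
    have hk' := h.section_X_sub_C_mul ha hk
    rw [polySection_X_sub_C_mul (by omega) l] at hs ⊢
    refine PolyInterlaces.add_right hs ?_ (h1.C_mul_right (neg_nonneg.2 ha))
    rw [polySection_X_sub_C_mul (by omega)] at hk' ⊢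
    exact (h.X_mul k l hlk hk).add_left hk'
      ((h.interlaces_section_X_mul hlk hk).C_mul_left (neg_nonneg.2 ha))

theorem C_mul (h : SectionsInterlace r P) {c : ℝ} (hc : 0 ≤ c) :
    SectionsInterlace r (C c * P) := by
  intro k l hlk hk
  rw [polySection_C_mul (by omega), polySection_C_mul (by omega)]
  exact ((h k l hlk hk).C_mul_left hc).C_mul_right hc

end SectionsInterlace

theorem sectionsInterlace_one : SectionsInterlace r 1 := by
  have h1 : IsNonnegRealRooted (1 : ℝ[X]) := by
    refine ⟨Or.inr fun z hz => by simp at hz, fun n => ?_⟩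
    rw [coeff_one]
    split_ifs <;> norm_num
  have hz : ∀ k, 0 < r → polySection r k 1 = if k = 0 then 1 else 0 := by
    intro k hr
    ext n
    rw [coeff_polySection r k hr, coeff_one]
    split_ifs with h h' h'
    · have : n = 0 := by
        have := Nat.mul_eq_zero.1 (show r * n = 0 by omega)
        omega
      simp [this]
    · omega
    · subst h'
      have : n ≠ 0 := by
        rintro rfl
        simp at h
      simp [coeff_one, this]
    · simp
  intro k l hlk hk
  rw [hz k (by omega), hz l (by omega)]
  by_cases hk0 : k = 0
  · obtain rfl : l = 0 := by omega
    simpa [hk0] using h1.interlaces_self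
  · rw [if_neg hk0]
    refine IsNonnegRealRooted.zero_interlaces ?_
    split_ifs
    exacts [h1, isNonnegRealRooted_zero]

/-- Induction on the roots: each factor `X - a` with `a ≤ 0` preserves the relations. -/
theorem sectionsInterlace_of_isNonnegRealRooted {P : ℝ[X]} (hP : IsNonnegRealRooted P) :
    SectionsInterlace r P := by
  by_cases h0 : P = 0
  · intro k l _ hk
    rw [h0, polySection_zero (by omega), polySection_zero (by omega)]
    exact isNonnegRealRooted_zero.interlaces_self
  · obtain ⟨⟨hs, hl⟩, hx⟩ := (isNonnegRealRooted_iff h0).1 hP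
    rw [hs.eq_prod_roots]
    refine SectionsInterlace.C_mul ?_ hl.le
    generalize P.roots = m at hx
    induction m using Multiset.induction_on with
    | empty => simpa using sectionsInterlace_one
    | cons a m ih =>
      rw [Multiset.map_cons, Multiset.prod_cons]
      exact (ih fun x hxm => hx x (Multiset.mem_cons_of_mem hxm)).X_sub_C_mul
        (hx a (Multiset.mem_cons_self a m))

/-! ### Sections of a pair of interlacing polynomials -/

theorem IsNonnegRealRooted.of_X_sub_C_mul {q : ℝ[X]} {t : ℝ} (h0 : (X - C t) * q ≠ 0)
    (h : IsNonnegRealRooted ((X - C t) * q)) : t ≤ 0 ∧ IsNonnegRealRooted q := by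
  obtain ⟨h1, h2⟩ := (isNonnegRealRooted_iff h0).1 h
  rw [isPosSplit_X_sub_C_mul] at h1
  rw [roots_mul h0, roots_X_sub_C, Multiset.singleton_add] at h2
  exact ⟨h2 t (Multiset.mem_cons_self t _), (isNonnegRealRooted_iff h1.ne_zero).2
    ⟨h1, fun x hx => h2 x (Multiset.mem_cons_of_mem hx)⟩⟩

/-- The relations between the sections of an interlacing pair. They are additive in `P`, which is a
nonnegative combination of `Q` and its quotients `q` by linear factors; for these they follow from
the relations between the sections of `q` alone. -/
theorem PolyInterlaces.sections {P Q : ℝ[X]} (h : PolyInterlaces P Q) {k l : ℕ} (hk : k < r) :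
    (l ≤ k → PolyInterlaces (polySection r k P) (polySection r l Q)) ∧
    (l < k → PolyInterlaces (polySection r k Q) (polySection r l P)) := by
  have hr : 0 < r := by omega
  have hSP : SectionsInterlace r P := sectionsInterlace_of_isNonnegRealRooted h.left
  have hSQ : SectionsInterlace r Q := sectionsInterlace_of_isNonnegRealRooted h.right
  by_cases hP0 : P = 0
  · rw [hP0, polySection_zero hr, polySection_zero hr]
    exact ⟨fun hlk => (hSQ.section_left (by omega)).zero_interlaces,
      fun _ => (hSQ.section_left hk).interlaces_zero⟩
  by_cases hQ0 : Q = 0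
  · rw [hQ0, polySection_zero hr, polySection_zero hr]
    exact ⟨fun _ => (hSP.section_left hk).interlaces_zero,
      fun hlk => (hSP.section_left (by omega)).zero_interlaces⟩
  have hmem : P ∈ quotientCone Q :=
    (((polyInterlaces_iff.1 h).2.2.resolve_left hP0).resolve_left hQ0).mem_quotientCone
      ((isNonnegRealRooted_iff hP0).1 h.left).1 ((isNonnegRealRooted_iff hQ0).1 h.right).1
  constructor
  · intro hlk
    by_cases hQl : polySection r l Q = 0
    · rw [hQl]
      exact (hSP.section_left hk).interlaces_zero
    refine AddSubmonoid.closure_induction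
      (motive := fun p _ => PolyInterlaces (polySection r k p) (polySection r l Q))
      (fun F hF => ?_) ?_ (fun F G _ _ hF hG => ?_) hmem
    · obtain ⟨c, hc, rfl | ⟨t, q, rfl, rfl⟩⟩ := hF
      · rw [polySection_C_mul hr]
        exact (hSQ k l hlk hk).C_mul_left hc
      · obtain ⟨ht, hq⟩ := h.right.of_X_sub_C_mul hQ0
        rw [polySection_C_mul hr]
        exact ((sectionsInterlace_of_isNonnegRealRooted hq).interlaces_section_X_sub_C_mul
          ht hlk hk).C_mul_left hc
    · rw [polySection_zero hr]
      exact (hSQ.section_left (by omega)).zero_interlaces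
    · rw [polySection_add hr]
      exact hF.add_left_of_ne_zero hQl hG
  · intro hlk
    by_cases hQk : polySection r k Q = 0
    · rw [hQk]
      exact (hSP.section_left (by omega)).zero_interlaces
    refine AddSubmonoid.closure_induction
      (motive := fun p _ => PolyInterlaces (polySection r k Q) (polySection r l p))
      (fun F hF => ?_) ?_ (fun F G _ _ hF hG => ?_) hmem
    · obtain ⟨c, hc, rfl | ⟨t, q, rfl, rfl⟩⟩ := hF
      · rw [polySection_C_mul hr]
        exact (hSQ k l hlk.le hk).C_mul_right hc
      · obtain ⟨ht, hq⟩ := h.right.of_X_sub_C_mul hQ0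
        rw [polySection_C_mul hr]
        exact ((sectionsInterlace_of_isNonnegRealRooted hq).section_X_sub_C_mul_interlaces
          ht hlk hk).C_mul_right hc
    · rw [polySection_zero hr]
      exact (hSQ.section_left hk).interlaces_zero
    · rw [polySection_add hr]
      exact hF.add_right_of_ne_zero hQk hG

end Sections

theorem isPairwiseInterlacing_sections {r : ℕ} {P Q : ℝ[X]} (h : PolyInterlaces P Q) :
    IsPairwiseInterlacing (antiflip (interleavedRow r
      (fun k => polySection r k Q) (fun k => polySection r k P))) := by
  intro i j hij
  have hij : (i : ℕ) < j := hij
  have hi := i.rev.isLt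
  have hi' : (i.rev : ℕ) = 2 * r - (i + 1) := Fin.val_rev i
  have hj' : (j.rev : ℕ) = 2 * r - (j + 1) := Fin.val_rev j
  have hj := j.isLt
  simp only [antiflip, interleavedRow]
  split_ifs with h1 h2 h2
  · exact sectionsInterlace_of_isNonnegRealRooted h.right _ _ (by omega) (by omega)
  · exact (h.sections (by omega)).2 (by omega)
  · exact (h.sections (by omega)).1 (by omega)
  · exact sectionsInterlace_of_isNonnegRealRooted h.left _ _ (by omega) (by omega)

/-! ### Sections of a pair of power series -/

theorem IsTP.submatrix {m n m' n' : Type*} [Preorder m] [Preorder n] [Preorder m'] [Preorder n']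
    {M : Matrix m n ℝ} (hM : IsTP M) {f : m' → m} {g : n' → n} (hf : StrictMono f)
    (hg : StrictMono g) : IsTP (M.submatrix f g) :=
  fun s f' g' hf' hg' => hM s (f ∘ f') (g ∘ g') (hf.comp hf') (hg.comp hg')

theorem zcoeff_seriesSection {r k : ℕ} (hk : k < r) (n : ℤ) (A : ℝ⟦X⟧) :
    zcoeff n (seriesSection r k A) = zcoeff (k + r * n) A := by
  unfold zcoeff
  by_cases hn : 0 ≤ n
  · obtain ⟨m, rfl⟩ := Int.eq_ofNat_of_zero_le hn
    rw [if_pos hn, if_pos (by positivity)]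
    simp only [seriesSection, PowerSeries.coeff_mk, Int.toNat_natCast]
    congr 2
  · have : (k : ℤ) + r * n < 0 := by nlinarith
    rw [if_neg hn, if_neg (not_le.2 this)]

/-- The definition of `lace` with row and column indices already divided with remainder. -/
theorem lace_apply {p q : ℕ} [NeZero p] [NeZero q] (M : Matrix (Fin p) (Fin q) ℝ⟦X⟧)
    (u v : ℤ) (i : Fin p) (j : Fin q) :
    lace M (u * p + i) (v * q + j) = zcoeff (v - u) (M i j) := by
  have hu := (Int.divModEquiv p).apply_symm_apply (u, i)
  have hv := (Int.divModEquiv q).apply_symm_apply (v, j)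
  rw [Int.divModEquiv_symm_apply] at hu hv
  simp only [lace, hu, hv]

/-- The interlacing matrix of the interleaved sections keeps all rows of that of the column `A`,
`B` and every `r`-th column, starting from the column `r - 1`. -/
theorem lace_sections (r : ℕ) [NeZero r] (A B : ℝ⟦X⟧) :
    lace (antiflip (interleavedRow r
      (fun k => seriesSection r k B) (fun k => seriesSection r k A))) =
    (lace !![A; B]).submatrix id fun v => r * v + (r - 1) := by
  ext u v
  obtain ⟨⟨u, i⟩, rfl⟩ := (Int.divModEquiv (2 * r)).symm.surjective u
  have hi := i.isLt
  have hi' : (i.rev : ℕ) = 2 * r - (i + 1) := Fin.val_rev i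
  have hk : (i.rev : ℕ) / 2 < r := by omega
  have h1 := lace_apply (antiflip (interleavedRow r
    (fun k => seriesSection r k B) (fun k => seriesSection r k A))) u v i 0
  have h2 := lace_apply !![A; B] (u * r + (i : ℕ) / 2) (r * v + (r - 1))
    (if (i.rev : ℕ) % 2 = 0 then 1 else 0) 0
  have hn : ((i.rev : ℕ) / 2 : ℕ) + (r : ℤ) * (v - u) =
      r * v + (r - 1) - (u * r + (i : ℕ) / 2) := by
    rw [show (((i.rev : ℕ) / 2 : ℕ) : ℤ) = r - 1 - (i : ℕ) / 2 by omega]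
    ring
  simp only [Fin.val_zero, Nat.cast_one, Nat.cast_zero, mul_one, add_zero] at h1 h2
  rw [Int.divModEquiv_symm_apply, h1, Matrix.submatrix_apply, id]
  simp only [antiflip, interleavedRow]
  split_ifs at h2 ⊢ with hpar
  · rw [zcoeff_seriesSection hk, hn]
    refine Eq.trans rfl (h2.symm.trans (congrArg (lace !![A; B] · _) ?_))
    push_cast
    have : (i : ℤ) = 2 * ((i : ℤ) / 2) + 1 := by omega
    simp only [Fin.val_one, Nat.cast_one]
    linear_combination -this
  · rw [zcoeff_seriesSection hk, hn]
    refine Eq.trans rfl (h2.symm.trans (congrArg (lace !![A; B] · _) ?_))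
    push_cast
    have : (i : ℤ) = 2 * ((i : ℤ) / 2) := by omega
    simp only [Fin.val_zero, Nat.cast_zero]
    linear_combination -this

end Interlacing

theorem corollary5p3 (r : ℕ) [NeZero r] :
    (∀ A B : ℝ⟦X⟧, SeriesInterlaces A B →
      IsFullyInterlacing (antiflip (interleavedRow r
        (fun k => seriesSection r k B) (fun k => seriesSection r k A)))) ∧
    (∀ P Q : ℝ[X], PolyInterlaces P Q →
      IsPairwiseInterlacing (antiflip (interleavedRow r
        (fun k => polySection r k Q) (fun k => polySection r k P))) ∧
      ∀ k < r, PolyInterlaces (polySection r k P) (polySection r k Q)) := by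
  refine ⟨fun A B h => ?_, fun P Q h =>
    ⟨isPairwiseInterlacing_sections h, fun k hk => (h.sections hk).1 le_rfl⟩⟩
  have hr : (0 : ℤ) < r := by exact_mod_cast Nat.pos_of_neZero r
  rw [IsFullyInterlacing, lace_sections]
  exact IsTP.submatrix h strictMono_id fun v w hvw => by nlinarith
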